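/- Let $\mathbb{O}$ be the octonions, with conjugation $x\mapsto\bar x$, real part $\mathrm{Re}$, $|x|^2=x\bar x$, associator $[x,y,z]=(xy)z-x(yz)$, and $\Phi(x,y,z)=\tfrac12\mathrm{Re}\big(x(\bar y z)-z(\bar y x)\big)$. Let $$A=\begin{pmatrix}p&a&\bar b\\ \bar a&m&c\\ b&\bar c&n\end{pmatrix},\qquad p,m,n\in\mathbb{R},\ a,b,c\in\mathbb{O},$$ be a $3\times3$ octonionic Hermitian matrix, and for such matrices put $$\det A=pmn+b(ac)+\overline{b(ac)}-n|a|^2-m|b|^2-p|c|^2 .$$ A real root $r$ of $$r^2+4\,\Phi(a,b,c)\,r-\big|[a,b,c]\big|^2=0$$ labels a *family* of real eigenvalues of $A$: the three roots $\lambda_1,\lambda_2,\lambda_3$, counted with multiplicity, of the modified characteristic equation $\det(\lambda I-A)=r$. Such real roots $r$ exist, and for each of them the three roots $\lambda_1,\lambda_2,\lambda_3$ of $\det(\lambda I-A)=r$ are real and there are vectors $v_1,v_2,v_3\in\mathbb{O}^3$ such that 1. $A v_m=\lambda_m v_m$ for $m=1,2,3$; 2. $v_1,v_2,v_3$ form an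 orthonormal basis in the generalized sense: $v_m^\dagger v_m=1$ for all $m$; $(v_m v_m^\dagger)\,v_k=0$ for all $m\neq k$; and $\sum_{m=1}^3 v_m v_m^\dagger=I$ (so that $w=\sum_m (v_m v_m^\dagger)w$ for all $w\in\mathbb{O}^3$); 3. $A=\sum_{m=1}^{3}\lambda_m\,v_m v_m^\dagger$. -/

import Mathlib

open scoped Quaternion Matrix

/-- The octonions `𝕆 = ℍ + ℍℓ`, by Cayley–Dickson doubling of the quaternions:
`⟨p, q⟩` stands for `p + q ℓ`. -/
@[ext]
structure Octonion where
  /-- the component in `ℍ` -/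
  fst : ℍ[ℝ]
  /-- the coefficient of `ℓ` -/
  snd : ℍ[ℝ]

namespace Octonion

noncomputable section

instance : Zero Octonion := ⟨⟨0, 0⟩⟩
instance : One Octonion := ⟨⟨1, 0⟩⟩
instance : Add Octonion := ⟨fun x y => ⟨x.fst + y.fst, x.snd + y.snd⟩⟩
instance : Neg Octonion := ⟨fun x => ⟨-x.fst, -x.snd⟩⟩
instance : Sub Octonion := ⟨fun x y => ⟨x.fst - y.fst, x.snd - y.snd⟩⟩
instance : SMul ℝ Octonion := ⟨fun t x => ⟨t • x.fst, t • x.snd⟩⟩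

/-- `(p + q ℓ)(s + t ℓ) = (p s - t̄ q) + (t p + q s̄) ℓ`. -/
instance : Mul Octonion :=
  ⟨fun x y => ⟨x.fst * y.fst - star y.snd * x.snd, y.snd * x.fst + x.snd * star y.fst⟩⟩

/-- Octonionic conjugation. -/
instance : Star Octonion := ⟨fun x => ⟨star x.fst, -x.snd⟩⟩

@[simp] theorem zero_fst : (0 : Octonion).fst = 0 := rfl
@[simp] theorem zero_snd : (0 : Octonion).snd = 0 := rfl
@[simp] theorem one_fst : (1 : Octonion).fst = 1 := rfl
@[simp] theorem one_snd : (1 : Octonion).snd = 0 := rfl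
@[simp] theorem add_fst (x y : Octonion) : (x + y).fst = x.fst + y.fst := rfl
@[simp] theorem add_snd (x y : Octonion) : (x + y).snd = x.snd + y.snd := rfl
@[simp] theorem neg_fst (x : Octonion) : (-x).fst = -x.fst := rfl
@[simp] theorem neg_snd (x : Octonion) : (-x).snd = -x.snd := rfl
@[simp] theorem sub_fst (x y : Octonion) : (x - y).fst = x.fst - y.fst := rfl
@[simp] theorem sub_snd (x y : Octonion) : (x - y).snd = x.snd - y.snd := rfl
@[simp] theorem smul_fst (t : ℝ) (x : Octonion) : (t • x).fst = t • x.fst := rfl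
@[simp] theorem smul_snd (t : ℝ) (x : Octonion) : (t • x).snd = t • x.snd := rfl
@[simp] theorem mul_fst (x y : Octonion) :
    (x * y).fst = x.fst * y.fst - star y.snd * x.snd := rfl
@[simp] theorem mul_snd (x y : Octonion) :
    (x * y).snd = y.snd * x.fst + x.snd * star y.fst := rfl
@[simp] theorem star_fst (x : Octonion) : (star x).fst = star x.fst := rfl
@[simp] theorem star_snd (x : Octonion) : (star x).snd = -x.snd := rfl

instance : AddCommGroup Octonion where
  add_assoc x y z := by apply Octonion.ext <;> simp [add_assoc]
  zero_add x := by apply Octonion.ext <;> simp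
  add_zero x := by apply Octonion.ext <;> simp
  add_comm x y := by apply Octonion.ext <;> simp [add_comm]
  neg_add_cancel x := by apply Octonion.ext <;> simp
  sub_eq_add_neg x y := by apply Octonion.ext <;> simp [sub_eq_add_neg]
  nsmul := nsmulRec
  zsmul := zsmulRec

instance : NonAssocRing Octonion where
  left_distrib x y z := by
    apply Octonion.ext
    · simp only [mul_fst, add_fst, add_snd, star_add, mul_add, add_mul]; abel
    · simp only [mul_snd, add_fst, add_snd, star_add, mul_add, add_mul]; abel
  right_distrib x y z := by
    apply Octonion.ext
    · simp only [mul_fst, add_fst, add_snd, mul_add, add_mul]; abel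
    · simp only [mul_snd, add_fst, add_snd, mul_add, add_mul]; abel
  zero_mul x := by apply Octonion.ext <;> simp
  mul_zero x := by apply Octonion.ext <;> simp
  one_mul x := by apply Octonion.ext <;> simp
  mul_one x := by apply Octonion.ext <;> simp

instance : StarRing Octonion where
  star_involutive x := by apply Octonion.ext <;> simp
  star_mul x y := by apply Octonion.ext <;> simp [sub_eq_add_neg, add_comm]
  star_add x y := by apply Octonion.ext <;> simp [add_comm]

instance : Module ℝ Octonion where
  one_smul x := by apply Octonion.ext <;> simp
  mul_smul s t x := by apply Octonion.ext <;> simp [mul_smul]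
  smul_zero t := by apply Octonion.ext <;> simp
  smul_add t x y := by apply Octonion.ext <;> simp
  add_smul s t x := by apply Octonion.ext <;> simp [add_smul]
  zero_smul x := by apply Octonion.ext <;> simp

/-- The real part. -/
def re (x : Octonion) : ℝ := x.fst.re

/-- The squared norm `|x|² = x x̄`, as a real number. -/
def normSq (x : Octonion) : ℝ := re (x * star x)

/-- The associator `[x, y, z] = (x y) z - x (y z)`. -/
def assoc (x y z : Octonion) : Octonion := x * y * z - x * (y * z)

/-- The associative 3-form `Φ(x, y, z) = ½ Re (x (ȳ z) - z (ȳ x))`. -/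
def Phi (x y z : Octonion) : ℝ := (1 / 2) * re (x * (star y * z) - z * (star y * x))

/-- The determinant of a Hermitian matrix with real diagonal `p, m, n` and off-diagonal entries
`a = A₁₂`, `b = A₃₁`, `c = A₂₃`:
`p m n + b (a c) + conj (b (a c)) - n |a|² - m |b|² - p |c|²`. -/
def det (A : Matrix (Fin 3) (Fin 3) Octonion) : ℝ :=
  re (A 0 0) * re (A 1 1) * re (A 2 2)
    + re (A 2 0 * (A 0 1 * A 1 2) + star (A 2 0 * (A 0 1 * A 1 2)))
    - re (A 2 2) * normSq (A 0 1) - re (A 1 1) * normSq (A 2 0) - re (A 0 0) * normSq (A 1 2)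

/-- `r` is a root of `r² + 4 Φ(a, b, c) r - |[a, b, c]|² = 0`, where `a = A₁₂`, `b = A₃₁`,
`c = A₂₃`. Each such `r` labels a family of real eigenvalues of `A`. -/
def IsFamilyLabel (A : Matrix (Fin 3) (Fin 3) Octonion) (r : ℝ) : Prop :=
  r ^ 2 + 4 * Phi (A 0 1) (A 2 0) (A 1 2) * r - normSq (assoc (A 0 1) (A 2 0) (A 1 2)) = 0

/-- `ev 0, ev 1, ev 2` are, with multiplicity, the three roots `x` of the modified characteristic
equation `det (x I - A) = r`. -/
def IsFamily (A : Matrix (Fin 3) (Fin 3) Octonion) (r : ℝ) (ev : Fin 3 → ℝ) : Prop :=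
  ∀ x : ℝ, det (x • (1 : Matrix (Fin 3) (Fin 3) Octonion) - A) - r = ∏ m, (x - ev m)

/-- An orthonormal basis of `𝕆³` in the generalized sense: unit vectors, pairwise orthogonal in
the sense `(v v†) w = 0`, and complete, `∑ v v† = I`, so that `w = ∑ (v v†) w` for all `w`. -/
structure IsOrthonormalBasis (v : Fin 3 → Fin 3 → Octonion) : Prop where
  unit : ∀ m, star (v m) ⬝ᵥ v m = 1
  orthogonal : ∀ m k, m ≠ k → Matrix.vecMulVec (v m) (star (v m)) *ᵥ v k = 0
  complete : ∑ m, Matrix.vecMulVec (v m) (star (v m)) = 1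

end

end Octonion

open scoped Quaternion Matrix

namespace Octonion

noncomputable section

/-! Solving the first two rows of the eigenvalue equation with third entry a real multiple of an
octonion `z` reduces the third row to `cycleOp a b c z = ρ • z`, where `ρ` is the value of the cubic
in `CharEq`. Because of nonassociativity `cycleOp` is not scalar. On the span of `1` and the
associator `d` its eigenvalues are `2 Re (b (a c)) + r` with `r² + 4 Φ r - |d|² = 0`, so each label
`r` supplies a suitable `z` (`exists_cycleOp_eq_smul`).

Fix such a `z`. For every root `x`, `v v†` is a real multiple of `adj`, which is quadratic in `x`
with matrix coefficients that depend on `z` but not on `x` (`vecMulVec_eigenvec`). With three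
distinct roots, `v v†` normalized is `adj` divided by the derivative of the cubic; orthogonality,
completeness and the decomposition of `A` are then divided-difference identities
(`hasEigenbasis_of_adjugate`).

Reality and distinctness come from interlacing with the two roots of the upper-left 2×2 minor. This
can fail in degenerate cases, where moreover the candidate vector may vanish. Those are limits of
good matrices with the same `r`, and having an eigenbasis is a closed condition because triples of
unit vectors form a compact set (`isClosed_hasEigenbasis`). -/

instance : IsScalarTower ℝ Octonion Octonion where
  smul_assoc t x y := by apply Octonion.ext <;> simp [smul_sub]

instance : SMulCommClass ℝ Octonion Octonion where
  smul_comm t x y := by apply Octonion.ext <;> simp [smul_sub]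

instance : StarModule ℝ Octonion where
  star_smul t x := by apply Octonion.ext <;> simp

/-! ### Octonion algebra: trace, alternativity, Moufang, norm. -/

theorem re_add (x y : Octonion) : re (x + y) = re x + re y := by simp [re]
theorem re_sub (x y : Octonion) : re (x - y) = re x - re y := by simp [re]
theorem re_neg (x : Octonion) : re (-x) = -re x := by simp [re]
theorem re_smul (t : ℝ) (x : Octonion) : re (t • x) = t * re x := by simp [re]
theorem re_star (x : Octonion) : re (star x) = re x := by simp [re]
theorem re_zero : re 0 = 0 := by simp [re]
theorem re_one : re 1 = 1 := by simp [re]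

theorem re_mul_comm (x y : Octonion) : re (x * y) = re (y * x) := by
  simp [re]; ring

theorem re_mul_assoc (x y z : Octonion) : re (x * y * z) = re (x * (y * z)) := by
  simp [re]; ring

theorem star_eq (x : Octonion) : star x = (2 * re x) • 1 - x := by
  apply Octonion.ext <;> apply Quaternion.ext <;> simp [re]; ring

theorem add_star_eq (x : Octonion) : x + star x = (2 * re x) • 1 := by
  rw [star_eq]; abel

theorem normSq_star (x : Octonion) : normSq (star x) = normSq x := by
  simp [normSq, re]

set_option linter.unusedSimpArgs false in
theorem star_mul_cancel_left (x y : Octonion) : star x * (x * y) = normSq x • y := by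
  apply Octonion.ext <;> apply Quaternion.ext <;>
    simp only [re, normSq, mul_fst, mul_snd, add_fst, add_snd, sub_fst, sub_snd, smul_fst, smul_snd,
      star_fst, star_snd, Quaternion.re_mul, Quaternion.imI_mul, Quaternion.imJ_mul,
      Quaternion.imK_mul,
      Quaternion.re_add, Quaternion.imI_add, Quaternion.imJ_add, Quaternion.imK_add,
      Quaternion.re_sub, Quaternion.imI_sub, Quaternion.imJ_sub, Quaternion.imK_sub,
      Quaternion.re_star, Quaternion.imI_star, Quaternion.imJ_star, Quaternion.imK_star,
      Quaternion.re_neg, Quaternion.imI_neg, Quaternion.imJ_neg, Quaternion.imK_neg, star_neg,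
      Quaternion.re_smul, Quaternion.imI_smul, Quaternion.imJ_smul, Quaternion.imK_smul,
      smul_eq_mul] <;> ring

theorem mul_star_cancel_left (x y : Octonion) : x * (star x * y) = normSq x • y := by
  simpa [normSq_star] using star_mul_cancel_left (star x) y

theorem mul_star_cancel_right (x y : Octonion) : x * y * star y = normSq y • x := by
  simpa [normSq_star] using congrArg star (mul_star_cancel_left y (star x))

theorem star_mul_cancel_right (x y : Octonion) : x * star y * y = normSq y • x := by
  simpa [normSq_star] using congrArg star (star_mul_cancel_left y (star x))

theorem mul_star_self_eq (x : Octonion) : x * star x = normSq x • 1 := by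
  simpa using mul_star_cancel_right 1 x

theorem star_mul_self_eq (x : Octonion) : star x * x = normSq x • 1 := by
  simpa using star_mul_cancel_left x 1

set_option linter.unusedSimpArgs false in
theorem left_alternative_polarized (a z x : Octonion) :
    a * (z * x) = (a * z + z * a) * x - z * (a * x) := by
  apply Octonion.ext <;> apply Quaternion.ext <;>
    simp only [mul_fst, mul_snd, add_fst, add_snd, sub_fst, sub_snd, smul_fst, smul_snd,
      star_fst, star_snd, Quaternion.re_mul, Quaternion.imI_mul, Quaternion.imJ_mul,
      Quaternion.imK_mul,
      Quaternion.re_add, Quaternion.imI_add, Quaternion.imJ_add, Quaternion.imK_add,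
      Quaternion.re_sub, Quaternion.imI_sub, Quaternion.imJ_sub, Quaternion.imK_sub,
      Quaternion.re_star, Quaternion.imI_star, Quaternion.imJ_star, Quaternion.imK_star] <;> ring

set_option linter.unusedSimpArgs false in
/-- The middle Moufang identity. -/
theorem moufang_middle (a x y : Octonion) : a * x * (y * a) = a * (x * y) * a := by
  apply Octonion.ext <;> apply Quaternion.ext <;>
    simp only [mul_fst, mul_snd, add_fst, add_snd, sub_fst, sub_snd, smul_fst, smul_snd,
      star_fst, star_snd, Quaternion.re_mul, Quaternion.imI_mul, Quaternion.imJ_mul,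
      Quaternion.imK_mul,
      Quaternion.re_add, Quaternion.imI_add, Quaternion.imJ_add, Quaternion.imK_add,
      Quaternion.re_sub, Quaternion.imI_sub, Quaternion.imJ_sub, Quaternion.imK_sub,
      Quaternion.re_star, Quaternion.imI_star, Quaternion.imJ_star, Quaternion.imK_star] <;> ring

theorem mul_mul_self_eq (a s : Octonion) :
    a * s * a = (2 * re (a * s)) • a - normSq a • star s := by
  have h : a * s = (2 * re (a * s)) • 1 - star s * star a := by
    rw [← star_mul, star_eq (a * s)]; abel
  conv_lhs => rw [h]
  rw [sub_mul, smul_mul_assoc, one_mul, star_mul_cancel_right]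

theorem normSq_eq (x : Octonion) : normSq x = ‖x.fst‖ ^ 2 + ‖x.snd‖ ^ 2 := by
  rw [sq, sq, ← Quaternion.normSq_eq_norm_mul_self, ← Quaternion.normSq_eq_norm_mul_self,
    Quaternion.normSq_def', Quaternion.normSq_def']
  simp [normSq, re]; ring

theorem normSq_nonneg (x : Octonion) : 0 ≤ normSq x := by
  rw [normSq_eq]; positivity

theorem normSq_eq_zero {x : Octonion} : normSq x = 0 ↔ x = 0 := by
  rw [normSq_eq]
  constructor
  · intro h
    have h1 : ‖x.fst‖ = 0 := by nlinarith [sq_nonneg ‖x.fst‖, sq_nonneg ‖x.snd‖]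
    have h2 : ‖x.snd‖ = 0 := by nlinarith [sq_nonneg ‖x.fst‖, sq_nonneg ‖x.snd‖]
    exact Octonion.ext (norm_eq_zero.1 h1) (norm_eq_zero.1 h2)
  · rintro rfl; simp

/-- The polarization of `normSq`. -/
def inner (x y : Octonion) : ℝ := re (x * star y)

theorem inner_self (x : Octonion) : inner x x = normSq x := rfl
theorem inner_comm (x y : Octonion) : inner x y = inner y x := by
  rw [inner, ← re_star, star_mul, star_star]; rfl
theorem inner_add_left (x y z : Octonion) : inner (x + y) z = inner x z + inner y z := by
  simp [inner, add_mul, re_add]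
theorem inner_sub_left (x y z : Octonion) : inner (x - y) z = inner x z - inner y z := by
  simp [inner, sub_mul, re_sub]
theorem inner_smul_left (t : ℝ) (x y : Octonion) : inner (t • x) y = t * inner x y := by
  rw [inner, inner, smul_mul_assoc, re_smul]
theorem inner_add_right (x y z : Octonion) : inner x (y + z) = inner x y + inner x z := by
  simp [inner, mul_add, re_add]
theorem inner_smul_right (t : ℝ) (x y : Octonion) : inner x (t • y) = t * inner x y := by
  rw [inner, inner, star_smul, star_trivial, mul_smul_comm, re_smul]
theorem inner_one_right (x : Octonion) : inner x 1 = re x := by simp [inner]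
theorem inner_mul_left (x y z : Octonion) : inner (x * y) z = inner y (star x * z) := by
  simp [inner, re]; ring
theorem inner_mul_right (x y z : Octonion) : inner (x * y) z = inner x (z * star y) := by
  simp [inner, re]; ring

theorem normSq_add (x y : Octonion) : normSq (x + y) = normSq x + 2 * inner x y + normSq y := by
  rw [← inner_self, inner_add_left, inner_add_right, inner_add_right, inner_comm y x, inner_self,
    inner_self]; ring

theorem normSq_smul (t : ℝ) (x : Octonion) : normSq (t • x) = t ^ 2 * normSq x := by
  rw [← inner_self, inner_smul_left, inner_smul_right, inner_self]; ring

theorem inner_mul_mul_left (x y z : Octonion) :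
    inner (x * y) (x * z) = normSq x * inner y z := by
  rw [inner_mul_left, star_mul_cancel_left, inner_smul_right]

theorem normSq_mul (x y : Octonion) : normSq (x * y) = normSq x * normSq y := by
  rw [← inner_self, inner_mul_mul_left, inner_self]

/-! ### Spectrum of the symmetrized cycle operator. -/

/-- The operator `L_b L_a L_c + (L_b L_a L_c)ᵀ`. -/
def cycleOp (a b c z : Octonion) : Octonion :=
  b * (a * (c * z)) + star c * (star a * (star b * z))

theorem cycleOp_sub (a b c y z : Octonion) :
    cycleOp a b c (y - z) = cycleOp a b c y - cycleOp a b c z := by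
  simp only [cycleOp, mul_sub]; abel

theorem cycleOp_smul (a b c : Octonion) (t : ℝ) (z : Octonion) :
    cycleOp a b c (t • z) = t • cycleOp a b c z := by
  simp only [cycleOp, mul_smul_comm, smul_add]

theorem star_eq_neg_of_re_eq_zero {z : Octonion} (hz : re z = 0) : star z = -z := by
  rw [star_eq, hz]; simp

theorem mul_eq_mul_star_of_inner_eq_zero {z x : Octonion} (hz : re z = 0) (hx : inner z x = 0) :
    x * z = z * star x := by
  have h := star_eq_neg_of_re_eq_zero (z := z * star x) hx
  rw [star_mul, star_star, star_eq_neg_of_re_eq_zero hz, mul_neg] at h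
  exact neg_injective h

/-- An imaginary `z` orthogonal to `x` can be pulled out to the left at the cost of conjugating `x`:
polarized left alternativity combined with `x z = z x̄`. -/
theorem mul_mul_eq_of_inner_eq_zero {z x : Octonion} (hz : re z = 0) (hx : inner z x = 0)
    (y : Octonion) : x * (z * y) = z * (star x * y) := by
  rw [left_alternative_polarized, mul_eq_mul_star_of_inner_eq_zero hz hx, ← mul_add,
    add_comm (star x), add_star_eq, star_eq x, sub_mul, mul_sub]
  simp only [mul_smul_comm, smul_mul_assoc, one_mul, mul_one]

theorem inner_star_right {z : Octonion} (hz : re z = 0) {x : Octonion} (hx : inner z x = 0) :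
    inner z (star x) = 0 := by
  rw [star_eq, inner_comm, inner_sub_left, inner_smul_left, inner_comm, inner_one_right,
    inner_comm x, hx, hz]; ring

theorem assoc_swap_left (x y z : Octonion) : assoc y x z = -assoc x y z := by
  have h := left_alternative_polarized x y z
  rw [add_mul] at h
  rw [assoc, assoc, neg_sub, h]; abel

theorem star_assoc (x y z : Octonion) :
    star (assoc x y z) = -assoc (star z) (star y) (star x) := by
  simp only [assoc, star_sub, star_mul]; abel

theorem assoc_swap_right (x y z : Octonion) : assoc x z y = -assoc x y z := by
  apply star_injective
  rw [star_neg, star_assoc, star_assoc, assoc_swap_left]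

theorem assoc_rotate (x y z : Octonion) : assoc z x y = assoc x y z := by
  rw [assoc_swap_left, assoc_swap_right, neg_neg]

theorem re_assoc (x y z : Octonion) : re (assoc x y z) = 0 := by
  rw [assoc, re_sub, re_mul_assoc, sub_self]

theorem inner_assoc_left (x y z : Octonion) : inner (assoc x y z) x = 0 := by
  have h := inner_mul_mul_left x (y * z) 1
  rw [mul_one] at h
  rw [assoc, inner_sub_left, inner_mul_right, inner_mul_mul_left, h, inner_one_right]
  simp [inner]

theorem inner_assoc_middle (x y z : Octonion) : inner (assoc x y z) y = 0 := by
  rw [← assoc_rotate, ← assoc_rotate, inner_assoc_left]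

theorem inner_assoc_right (x y z : Octonion) : inner (assoc x y z) z = 0 := by
  rw [← assoc_rotate, inner_assoc_left]

theorem cycleOp_one (a b c : Octonion) :
    cycleOp a b c 1 = (2 * re (b * (a * c))) • 1 + assoc a b c := by
  have h := add_star_eq (b * a * c)
  rw [re_mul_assoc] at h
  rw [← h, ← neg_neg (assoc a b c), ← assoc_swap_left]
  simp only [cycleOp, assoc, star_mul, mul_one]; abel

/-- Pulling `z` out past `a`, `b`, `c` conjugates and reassociates them, so the operator becomes a
right multiplication. It applies to `z = [a, b, c]`, which is orthogonal to `1, a, b, c`. -/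
theorem cycleOp_of_inner_eq_zero {a b c z : Octonion} (hz : re z = 0) (ha : inner z a = 0)
    (hb : inner z b = 0) (hc : inner z c = 0) :
    cycleOp a b c z = z * ((2 * re (c * (a * b))) • 1 - assoc a b c) := by
  have h := add_star_eq (c * a * b)
  rw [re_mul_assoc] at h
  rw [← h, ← assoc_rotate, cycleOp, mul_eq_mul_star_of_inner_eq_zero hz hc,
    mul_eq_mul_star_of_inner_eq_zero hz (inner_star_right hz hb),
    mul_mul_eq_of_inner_eq_zero hz ha, mul_mul_eq_of_inner_eq_zero hz hb,
    mul_mul_eq_of_inner_eq_zero hz (inner_star_right hz ha),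
    mul_mul_eq_of_inner_eq_zero hz (inner_star_right hz hc), ← mul_add]
  congr 1
  simp only [assoc, star_mul, star_star]; abel

theorem four_mul_Phi (a b c : Octonion) :
    4 * Phi a b c = 2 * re (b * (a * c)) - 2 * re (c * (a * b)) := by
  have h1 : re (a * (b * c)) = re (c * (a * b)) := by rw [← re_mul_assoc, re_mul_comm]
  have h2 : re (c * (b * a)) = re (b * (a * c)) := by
    rw [re_mul_comm, re_mul_assoc]
  have h3 := re_mul_comm a c
  rw [Phi, star_eq]
  simp only [sub_mul, mul_sub, smul_mul_assoc, mul_smul_comm, one_mul, re_sub, re_smul, h1, h2]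
  rw [h3]; ring

/-- The coordinate isomorphism with `ℍ × ℍ`. -/
def equivProd : Octonion ≃ₗ[ℝ] ℍ[ℝ] × ℍ[ℝ] where
  toFun x := (x.fst, x.snd)
  invFun x := ⟨x.1, x.2⟩
  map_add' _ _ := rfl
  map_smul' _ _ := rfl
  left_inv _ := rfl
  right_inv _ := rfl

instance : FiniteDimensional ℝ Octonion := equivProd.symm.finiteDimensional

theorem finrank_eq_eight : Module.finrank ℝ Octonion = 8 := by
  rw [equivProd.finrank_eq, Module.finrank_prod, Quaternion.finrank_eq_four]

theorem exists_ne_zero_inner_eq_zero (u : Fin 4 → Octonion) :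
    ∃ z : Octonion, z ≠ 0 ∧ ∀ i, inner z (u i) = 0 := by
  let f : Octonion →ₗ[ℝ] Fin 4 → ℝ :=
    { toFun := fun z i => inner z (u i)
      map_add' := fun x y => funext fun i => inner_add_left x y (u i)
      map_smul' := fun t x => funext fun i => inner_smul_left t x (u i) }
  have h : f.ker ≠ ⊥ := LinearMap.ker_ne_bot_of_finrank_lt (by simp [finrank_eq_eight])
  obtain ⟨z, hz, hz0⟩ := (Submodule.ne_bot_iff _).1 h
  exact ⟨z, hz0, fun i => congrFun (LinearMap.mem_ker.1 hz) i⟩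

/-- For `d = [a, b, c] ≠ 0` the span of `1` and `d` is invariant, and the label equation is the
characteristic equation of the operator there, shifted by `2 Re (b (a c))`. For `d = 0` the labels
are `0` and `-4 Φ`. -/
theorem exists_cycleOp_eq_smul {a b c : Octonion} {r : ℝ}
    (hr : r ^ 2 + 4 * Phi a b c * r - normSq (assoc a b c) = 0) :
    ∃ z : Octonion, z ≠ 0 ∧ cycleOp a b c z = (r + 2 * re (b * (a * c))) • z := by
  have hP := four_mul_Phi a b c
  by_cases hd : assoc a b c = 0
  · by_cases hr0 : r = 0
    · refine ⟨1, fun h => ?_, ?_⟩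
      · simpa [h, re_zero] using re_one
      · rw [cycleOp_one, hd, hr0]; simp
    -- Here `r = -4 Φ`, and any nonzero `z` orthogonal to these four vectors of the 8-dimensional
    -- space serves.
    · obtain ⟨z, hz, hu⟩ := exists_ne_zero_inner_eq_zero ![1, a, b, c]
      refine ⟨z, hz, ?_⟩
      have h1 : re z = 0 := by rw [← inner_one_right]; exact hu 0
      rw [cycleOp_of_inner_eq_zero (a := a) (b := b) (c := c) h1 (hu 1) (hu 2) (hu 3), hd,
        sub_zero, mul_smul_comm, mul_one]
      congr 1
      rw [hd, normSq_eq_zero.2 rfl] at hr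
      have : r + 4 * Phi a b c = 0 := by
        apply mul_left_cancel₀ hr0; linarith
      linarith
  · set d := assoc a b c with hd'
    have hre : re d = 0 := re_assoc a b c
    have hdd : d * d = -(normSq d • (1 : Octonion)) := by
      rw [← mul_star_self_eq, star_eq_neg_of_re_eq_zero hre, mul_neg, neg_neg]
    have hTd : cycleOp a b c d = (2 * re (c * (a * b))) • d + normSq d • 1 := by
      rw [cycleOp_of_inner_eq_zero hre (inner_assoc_left a b c) (inner_assoc_middle a b c)
        (inner_assoc_right a b c), ← hd', mul_sub, hdd, mul_smul_comm, mul_one, sub_neg_eq_add]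
    refine ⟨d - (-(4 * Phi a b c) - r) • 1, fun h => ?_, ?_⟩
    · have h1 := congrArg re h
      rw [re_sub, re_smul, hre, re_one, re_zero] at h1
      have h2 : -(4 * Phi a b c) - r = 0 := by linarith
      rw [h2, zero_smul, sub_zero] at h
      exact hd h
    · rw [cycleOp_sub, cycleOp_smul, hTd, cycleOp_one, ← hd']
      have e1 : normSq d = r ^ 2 + 4 * Phi a b c * r := by linarith
      have e2 : 2 * re (c * (a * b)) = 2 * re (b * (a * c)) - 4 * Phi a b c := by linarith
      rw [e1, e2]
      module

/-! ### Candidate eigenvectors and the modified adjugate. -/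

section

/-- The Hermitian matrix with diagonal `p, m, n` and off-diagonal entries `a = A₁₂`, `b = A₃₁`,
`c = A₂₃`. -/
def herm (p m n : ℝ) (a b c : Octonion) : Matrix (Fin 3) (Fin 3) Octonion :=
  !![p • 1, a, star b; star a, m • 1, c; b, star c, n • 1]

theorem eq_re_smul_one_of_star_eq {x : Octonion} (h : star x = x) : x = re x • 1 := by
  have h1 := add_star_eq x
  rw [h, ← two_smul ℝ x, mul_smul] at h1
  exact smul_right_injective _ two_ne_zero h1

theorem eq_herm {A : Matrix (Fin 3) (Fin 3) Octonion} (hA : A.IsHermitian) :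
    A = herm (re (A 0 0)) (re (A 1 1)) (re (A 2 2)) (A 0 1) (A 2 0) (A 1 2) := by
  ext1 i j
  fin_cases i <;> fin_cases j
  · exact eq_re_smul_one_of_star_eq (hA.apply 0 0)
  · rfl
  · exact (hA.apply 0 2).symm
  · exact (hA.apply 1 0).symm
  · exact eq_re_smul_one_of_star_eq (hA.apply 1 1)
  · rfl
  · rfl
  · exact (hA.apply 2 1).symm
  · exact eq_re_smul_one_of_star_eq (hA.apply 2 2)

theorem det_smul_one_sub_herm (p m n : ℝ) (a b c : Octonion) (x : ℝ) :
    det (x • (1 : Matrix (Fin 3) (Fin 3) Octonion) - herm p m n a b c) =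
      (x - p) * (x - m) * (x - n) - (x - n) * normSq a - (x - m) * normSq b - (x - p) * normSq c
        - 2 * re (b * (a * c)) := by
  have hstar : re (star c * star a * star b) = re (b * (a * c)) := by
    rw [← star_mul, ← star_mul, re_star]
  have hneg : ∀ y, normSq (-y) = normSq y := fun y => by simp [normSq]
  simp [det, herm, re_sub, re_smul, re_one, hneg, re_add, re_neg, hstar]
  ring

/-- The candidate eigenvector of `herm p m n a b c` for the eigenvalue `x`. -/
def eigenvec (p m : ℝ) (a b c z : Octonion) (x : ℝ) : Fin 3 → Octonion :=
  ![a * (c * z) + (x - m) • (star b * z), star a * (star b * z) + (x - p) • (c * z),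
    ((x - p) * (x - m) - normSq a) • z]

/-- The modified characteristic equation. -/
def CharEq (p m n : ℝ) (a b c : Octonion) (ρ x : ℝ) : Prop :=
  (x - p) * (x - m) * (x - n) - (x - n) * normSq a - (x - m) * normSq b - (x - p) * normSq c = ρ

variable {p m n ρ x : ℝ} {a b c z : Octonion}

/-- The first two rows hold by the choice of the first two entries; only the third needs `hz` and
`hx`. -/
theorem herm_mulVec_eigenvec (hz : cycleOp a b c z = ρ • z) (hx : CharEq p m n a b c ρ x) :
    herm p m n a b c *ᵥ eigenvec p m a b c z x = x • eigenvec p m a b c z x := by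
  ext1 i
  fin_cases i
  · simp [herm, eigenvec, Matrix.mulVec, dotProduct, Fin.sum_univ_three, mul_add,
      mul_star_cancel_left, mul_smul_comm]
    module
  · simp [herm, eigenvec, Matrix.mulVec, dotProduct, Fin.sum_univ_three, mul_add,
      star_mul_cancel_left, mul_smul_comm]
    module
  · have h : b * (a * (c * z)) = ρ • z - star c * (star a * (star b * z)) := by
      rw [← hz, cycleOp]; abel
    simp [herm, eigenvec, Matrix.mulVec, dotProduct, Fin.sum_univ_three, mul_add,
      mul_star_cancel_left, star_mul_cancel_left, mul_smul_comm, h]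
    rw [← hx]
    module

/-- Pair `hz` with `z`: the two summands of `cycleOp` are transposes, so they contribute equally. -/
theorem two_mul_inner_of_cycleOp (hz : cycleOp a b c z = ρ • z) :
    2 * inner (a * (c * z)) (star b * z) = ρ * normSq z := by
  have h := congrArg (inner · z) hz
  simp only [cycleOp] at h
  rw [inner_add_left, inner_mul_left b, inner_mul_left (star c), star_star, inner_mul_left (star a),
    star_star, inner_comm (star b * z), inner_smul_left, inner_self] at h
  linarith

/-- The constant coefficient of the modified adjugate of `x - A`. -/
def adjConst (p m n : ℝ) (a b c z : Octonion) : Matrix (Fin 3) (Fin 3) Octonion :=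
  herm (m * n - normSq c) (p * n - normSq b) (p * m - normSq a)
    ((normSq z)⁻¹ • (star b * z * star (c * z)) - n • a)
    ((normSq z)⁻¹ • (z * star (a * (c * z))) - m • b)
    ((normSq z)⁻¹ • (star a * (star b * z) * star z) - p • c)

/-- The modified adjugate of `x - A`. -/
def adj (p m n : ℝ) (a b c z : Octonion) (x : ℝ) : Matrix (Fin 3) (Fin 3) Octonion :=
  x ^ 2 • 1 + x • (herm p m n a b c - (p + m + n) • 1) + adjConst p m n a b c z

theorem adj_eq_herm : adj p m n a b c z x =
    herm ((x - m) * (x - n) - normSq c) ((x - p) * (x - n) - normSq b)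
      ((x - p) * (x - m) - normSq a)
      ((normSq z)⁻¹ • (star b * z * star (c * z)) + (x - n) • a)
      ((normSq z)⁻¹ • (z * star (a * (c * z))) + (x - m) • b)
      ((normSq z)⁻¹ • (star a * (star b * z) * star z) + (x - p) • c) := by
  ext1 i j
  fin_cases i <;> fin_cases j <;> simp [adj, adjConst, herm] <;> module

theorem normSq_eigenvec_zero (hz : cycleOp a b c z = ρ • z) (hx : CharEq p m n a b c ρ x) :
    normSq (eigenvec p m a b c z x 0) =
      normSq z * ((x - p) * (x - m) - normSq a) * ((x - m) * (x - n) - normSq c) := by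
  have h := two_mul_inner_of_cycleOp hz
  rw [CharEq] at hx
  simp only [eigenvec, Matrix.cons_val_zero, normSq_add, inner_smul_right, normSq_smul, normSq_mul,
    normSq_star]
  linear_combination (x - m) * h - (x - m) * normSq z * hx

theorem normSq_eigenvec_one (hz : cycleOp a b c z = ρ • z) (hx : CharEq p m n a b c ρ x) :
    normSq (eigenvec p m a b c z x 1) =
      normSq z * ((x - p) * (x - m) - normSq a) * ((x - p) * (x - n) - normSq b) := by
  have h := two_mul_inner_of_cycleOp hz
  rw [inner_mul_left, inner_comm] at h
  rw [CharEq] at hx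
  simp only [eigenvec, Matrix.cons_val_one, Matrix.cons_val_zero, normSq_add, inner_smul_right,
    normSq_smul, normSq_mul, normSq_star]
  linear_combination (x - p) * h - (x - p) * normSq z * hx

theorem normSq_eigenvec_two :
    normSq (eigenvec p m a b c z x 2) =
      normSq z * ((x - p) * (x - m) - normSq a) * ((x - p) * (x - m) - normSq a) := by
  simp only [eigenvec, Matrix.cons_val, normSq_smul]
  ring

/-- The only entry whose cross term does not cancel by alternativity. Middle Moufang turns it into
`a s a` with `s = (c z) conj(b̄ z)`, and `2 Re (a s)` is known from `two_mul_inner_of_cycleOp`. -/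
theorem eigenvec_zero_mul_star_one (hz0 : z ≠ 0) (hz : cycleOp a b c z = ρ • z)
    (hx : CharEq p m n a b c ρ x) :
    eigenvec p m a b c z x 0 * star (eigenvec p m a b c z x 1) =
      (normSq z * ((x - p) * (x - m) - normSq a)) •
        ((normSq z)⁻¹ • (star b * z * star (c * z)) + (x - n) • a) := by
  have hν : normSq z ≠ 0 := fun h => hz0 (normSq_eq_zero.1 h)
  have h := two_mul_inner_of_cycleOp hz
  rw [inner, re_mul_assoc] at h
  rw [CharEq] at hx
  have h1 : a * (c * z) * (star (star b * z) * a) = (ρ * normSq z) • a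
      - normSq a • (star b * z * star (c * z)) := by
    rw [moufang_middle, mul_mul_self_eq, h]
    simp only [star_mul, star_star]
  have h2 : star b * z * (star (star b * z) * a) = (normSq b * normSq z) • a := by
    rw [mul_star_cancel_left, normSq_mul, normSq_star]
  have h3 : a * (c * z) * star (c * z) = (normSq c * normSq z) • a := by
    rw [mul_star_cancel_right, normSq_mul]
  simp only [eigenvec, Matrix.cons_val_zero, Matrix.cons_val_one, star_add, star_smul,
    star_trivial, add_mul, mul_add, smul_mul_assoc, mul_smul_comm, smul_add]
  rw [star_mul (star a), star_star, h1, h2, h3, smul_smul _ (normSq z)⁻¹, mul_right_comm,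
    mul_inv_cancel₀ hν, ← hx]
  module

theorem eigenvec_zero_mul_star_two (hz0 : z ≠ 0) :
    eigenvec p m a b c z x 0 * star (eigenvec p m a b c z x 2) =
      (normSq z * ((x - p) * (x - m) - normSq a)) •
        star ((normSq z)⁻¹ • (z * star (a * (c * z))) + (x - m) • b) := by
  have hν : normSq z ≠ 0 := fun h => hz0 (normSq_eq_zero.1 h)
  simp only [eigenvec, Matrix.cons_val, star_add, star_smul, star_mul z, star_star,
    star_trivial, add_mul, smul_mul_assoc, mul_smul_comm, smul_add, mul_star_cancel_right]
  rw [smul_smul _ (normSq z)⁻¹, mul_right_comm, mul_inv_cancel₀ hν]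
  module

theorem eigenvec_one_mul_star_two (hz0 : z ≠ 0) :
    eigenvec p m a b c z x 1 * star (eigenvec p m a b c z x 2) =
      (normSq z * ((x - p) * (x - m) - normSq a)) •
        ((normSq z)⁻¹ • (star a * (star b * z) * star z) + (x - p) • c) := by
  have hν : normSq z ≠ 0 := fun h => hz0 (normSq_eq_zero.1 h)
  simp only [eigenvec, Matrix.cons_val, star_smul,
    star_trivial, add_mul, smul_mul_assoc, mul_smul_comm, smul_add, mul_star_cancel_right]
  rw [smul_smul _ (normSq z)⁻¹, mul_right_comm, mul_inv_cancel₀ hν]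
  module

theorem vecMulVec_eigenvec (hz0 : z ≠ 0) (hz : cycleOp a b c z = ρ • z)
    (hx : CharEq p m n a b c ρ x) :
    Matrix.vecMulVec (eigenvec p m a b c z x) (star (eigenvec p m a b c z x)) =
      (normSq z * ((x - p) * (x - m) - normSq a)) • adj p m n a b c z x := by
  have h01 := eigenvec_zero_mul_star_one (p := p) (m := m) (n := n) hz0 hz hx
  have h02 := eigenvec_zero_mul_star_two (p := p) (m := m) (a := a) (b := b) (c := c) (x := x) hz0
  have h12 := eigenvec_one_mul_star_two (p := p) (m := m) (a := a) (b := b) (c := c) (x := x) hz0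
  rw [adj_eq_herm]
  ext1 i j
  rw [Matrix.vecMulVec_apply, Pi.star_apply, Matrix.smul_apply]
  have hs : ∀ {u v y : Octonion} {t : ℝ}, u * star v = t • y → v * star u = t • star y :=
    fun h => by simpa using congrArg star h
  have h20 := hs h02
  rw [star_star] at h20
  have hdiag : ∀ {y : Octonion} {s t : ℝ}, normSq y = s * t → y * star y = s • t • 1 := by
    intro y s t h
    rw [mul_star_self_eq, h, mul_smul]
  fin_cases i <;> fin_cases j
  exacts [hdiag (normSq_eigenvec_zero hz hx), h01, h02, hs h01, hdiag (normSq_eigenvec_one hz hx), h12,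
    h20, hs h12, hdiag normSq_eigenvec_two]

end

/-! ### Spectral decomposition for distinct roots. -/

section

/-- `A` has an orthonormal eigenbasis for the family of eigenvalues labelled by `r`. -/
def HasEigenbasis (A : Matrix (Fin 3) (Fin 3) Octonion) (r : ℝ) : Prop :=
  ∃ (ev : Fin 3 → ℝ) (v : Fin 3 → Fin 3 → Octonion),
    IsFamily A r ev ∧ (∀ m, A *ᵥ v m = ev m • v m) ∧ IsOrthonormalBasis v ∧
      A = ∑ m, ev m • Matrix.vecMulVec (v m) (star (v m))

theorem star_dotProduct_self (v : Fin 3 → Octonion) :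
    star v ⬝ᵥ v = (∑ i, normSq (v i)) • (1 : Octonion) := by
  simp only [dotProduct, Pi.star_apply, star_mul_self_eq, Finset.sum_smul]

theorem vecMulVec_mulVec_self (v : Fin 3 → Octonion) :
    Matrix.vecMulVec v (star v) *ᵥ v = (∑ i, normSq (v i)) • v := by
  ext1 i
  simp only [Matrix.mulVec, dotProduct, Matrix.vecMulVec_apply, Pi.star_apply,
    star_mul_cancel_right, Pi.smul_apply, Finset.sum_smul]

theorem smul_one_injective {s t : ℝ} (h : s • (1 : Octonion) = t • 1) : s = t := by
  simpa [re_smul, re_one] using congrArg re h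

theorem smul_one_mulVec (t : ℝ) (v : Fin 3 → Octonion) :
    (t • (1 : Matrix (Fin 3) (Fin 3) Octonion)) *ᵥ v = t • v := by
  rw [Matrix.smul_mulVec, Matrix.one_mulVec]

/-- The derivative at `e i` of the monic cubic with roots `e 0, e 1, e 2`. -/
def derivAt (e : Fin 3 → ℝ) (i : Fin 3) : ℝ := 3 * e i ^ 2 - 2 * (e 0 + e 1 + e 2) * e i +
  (e 0 * e 1 + e 0 * e 2 + e 1 * e 2)

theorem derivAt_zero (e : Fin 3 → ℝ) : derivAt e 0 = (e 0 - e 1) * (e 0 - e 2) := by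
  rw [derivAt]; ring
theorem derivAt_one (e : Fin 3 → ℝ) : derivAt e 1 = (e 1 - e 0) * (e 1 - e 2) := by
  rw [derivAt]; ring
theorem derivAt_two (e : Fin 3 → ℝ) : derivAt e 2 = (e 2 - e 0) * (e 2 - e 1) := by
  rw [derivAt]; ring

theorem derivAt_ne_zero {e : Fin 3 → ℝ} (he : Function.Injective e) (i : Fin 3) :
    derivAt e i ≠ 0 := by
  have h : ∀ {i j}, i ≠ j → e i - e j ≠ 0 := fun hij => sub_ne_zero.2 (he.ne hij)
  fin_cases i
  · exact derivAt_zero e ▸ mul_ne_zero (h (by decide)) (h (by decide))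
  · exact derivAt_one e ▸ mul_ne_zero (h (by decide)) (h (by decide))
  · exact derivAt_two e ▸ mul_ne_zero (h (by decide)) (h (by decide))

/-- The left side is the first divided difference, at two of its roots, of the cubic with roots `e`.
-/
theorem divided_difference (e : Fin 3 → ℝ) {i j : Fin 3} (hij : i ≠ j) :
    e i ^ 2 + e i * (e j - (e 0 + e 1 + e 2)) +
      (derivAt e j - e j ^ 2 - e j * (e j - (e 0 + e 1 + e 2))) = 0 := by
  fin_cases i <;> fin_cases j <;> first | exact absurd rfl hij | (simp [derivAt]; ring)

theorem hasEigenbasis_of_adjugate {A C : Matrix (Fin 3) (Fin 3) Octonion} {r : ℝ}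
    {e : Fin 3 → ℝ} (he : Function.Injective e) (hfam : IsFamily A r e)
    {v : Fin 3 → Fin 3 → Octonion} (hv : ∀ i, A *ᵥ v i = e i • v i)
    (hunit : ∀ i, ∑ j, normSq (v i j) = 1)
    (hadj : ∀ i, Matrix.vecMulVec (v i) (star (v i)) =
      (derivAt e i)⁻¹ • (e i ^ 2 • 1 + e i • (A - (e 0 + e 1 + e 2) • 1) + C)) :
    HasEigenbasis A r := by
  have hD := derivAt_ne_zero he
  -- Nothing is known about `C` directly; its action on `v j` is read off from `(v v†) v = v` for a
  -- unit vector.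
  have hC : ∀ j, C *ᵥ v j =
      (derivAt e j - e j ^ 2 - e j * (e j - (e 0 + e 1 + e 2))) • v j := by
    intro j
    have h1 := vecMulVec_mulVec_self (v j)
    rw [hadj, hunit, one_smul, Matrix.smul_mulVec, inv_smul_eq_iff₀ (hD j), Matrix.add_mulVec,
      Matrix.add_mulVec, smul_one_mulVec, Matrix.smul_mulVec, Matrix.sub_mulVec, smul_one_mulVec,
      hv] at h1
    rw [← sub_eq_iff_eq_add'.2 h1.symm]
    module
  have h01 : e 0 - e 1 ≠ 0 := sub_ne_zero.2 (he.ne (by decide))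
  have h02 : e 0 - e 2 ≠ 0 := sub_ne_zero.2 (he.ne (by decide))
  have h12 : e 1 - e 2 ≠ 0 := sub_ne_zero.2 (he.ne (by decide))
  have h10 : e 1 - e 0 ≠ 0 := sub_ne_zero.2 (he.ne (by decide))
  have h20 : e 2 - e 0 ≠ 0 := sub_ne_zero.2 (he.ne (by decide))
  have h21 : e 2 - e 1 ≠ 0 := sub_ne_zero.2 (he.ne (by decide))
  -- These four sums are the second divided differences of `1, x, x², x³` at the roots.
  have s0 : (derivAt e 0)⁻¹ + (derivAt e 1)⁻¹ + (derivAt e 2)⁻¹ = 0 := by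
    rw [derivAt_zero, derivAt_one, derivAt_two]; field_simp; ring
  have s1 : (derivAt e 0)⁻¹ * e 0 + (derivAt e 1)⁻¹ * e 1 + (derivAt e 2)⁻¹ * e 2 = 0 := by
    rw [derivAt_zero, derivAt_one, derivAt_two]; field_simp; ring
  have s2 : (derivAt e 0)⁻¹ * e 0 ^ 2 + (derivAt e 1)⁻¹ * e 1 ^ 2 + (derivAt e 2)⁻¹ * e 2 ^ 2
      = 1 := by
    rw [derivAt_zero, derivAt_one, derivAt_two]; field_simp; ring
  have s3 : (derivAt e 0)⁻¹ * e 0 ^ 3 + (derivAt e 1)⁻¹ * e 1 ^ 3 + (derivAt e 2)⁻¹ * e 2 ^ 3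
      = e 0 + e 1 + e 2 := by
    rw [derivAt_zero, derivAt_one, derivAt_two]; field_simp; ring
  refine ⟨e, v, hfam, hv, ⟨fun i => ?_, fun i j hij => ?_, ?_⟩, ?_⟩
  · rw [star_dotProduct_self, hunit, one_smul]
  · rw [hadj, Matrix.smul_mulVec, Matrix.add_mulVec,
      Matrix.add_mulVec, smul_one_mulVec, Matrix.smul_mulVec, Matrix.sub_mulVec, smul_one_mulVec,
      hv, hC, ← sub_smul, smul_smul, ← add_smul, ← add_smul, divided_difference e hij, zero_smul,
      smul_zero]
  · simp only [hadj, Fin.sum_univ_three]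
    trans ((derivAt e 0)⁻¹ * e 0 ^ 2 + (derivAt e 1)⁻¹ * e 1 ^ 2 + (derivAt e 2)⁻¹ * e 2 ^ 2) • 1 +
      ((derivAt e 0)⁻¹ * e 0 + (derivAt e 1)⁻¹ * e 1 + (derivAt e 2)⁻¹ * e 2) •
        (A - (e 0 + e 1 + e 2) • 1) +
      ((derivAt e 0)⁻¹ + (derivAt e 1)⁻¹ + (derivAt e 2)⁻¹) • C
    · module
    · rw [s0, s1, s2]; simp
  · simp only [hadj, Fin.sum_univ_three]
    symm
    trans ((derivAt e 0)⁻¹ * e 0 ^ 3 + (derivAt e 1)⁻¹ * e 1 ^ 3 + (derivAt e 2)⁻¹ * e 2 ^ 3) • 1 +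
      ((derivAt e 0)⁻¹ * e 0 ^ 2 + (derivAt e 1)⁻¹ * e 1 ^ 2 + (derivAt e 2)⁻¹ * e 2 ^ 2) •
        (A - (e 0 + e 1 + e 2) • 1) +
      ((derivAt e 0)⁻¹ * e 0 + (derivAt e 1)⁻¹ * e 1 + (derivAt e 2)⁻¹ * e 2) • C
    · module
    · rw [s1, s2, s3]; simp

variable {p m n ρ r : ℝ} {a b c z : Octonion}

theorem charEq_of_isFamily {e : Fin 3 → ℝ} (hfam : IsFamily (herm p m n a b c) r e) (i : Fin 3) :
    CharEq p m n a b c (r + 2 * re (b * (a * c))) (e i) := by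
  have h := hfam (e i)
  rw [det_smul_one_sub_herm, Finset.prod_eq_zero (Finset.mem_univ i) (sub_self _)] at h
  rw [CharEq]; linarith

theorem IsFamily.sum_eq {e : Fin 3 → ℝ} (hfam : IsFamily (herm p m n a b c) r e) :
    e 0 + e 1 + e 2 = p + m + n := by
  have h0 := hfam 0
  have h1 := hfam 1
  have h2 := hfam (-1)
  simp only [det_smul_one_sub_herm, Fin.prod_univ_three] at h0 h1 h2
  linear_combination (1 / 2) * h1 + (1 / 2) * h2 - h0

/-- The derivative of the characteristic cubic is the sum of the principal 2×2 minors; this makes `v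
v†` have the right normalization. -/
theorem IsFamily.derivAt_eq {e : Fin 3 → ℝ} (hfam : IsFamily (herm p m n a b c) r e) (i : Fin 3) :
    derivAt e i = ((e i - m) * (e i - n) - normSq c) + ((e i - p) * (e i - n) - normSq b) +
      ((e i - p) * (e i - m) - normSq a) := by
  have h0 := hfam.sum_eq
  have h1 := hfam 1
  have h2 := hfam (-1)
  simp only [det_smul_one_sub_herm, Fin.prod_univ_three] at h1 h2
  rw [derivAt]
  linear_combination (1 / 2) * h2 - (1 / 2) * h1 - 2 * e i * h0

theorem sum_normSq_eigenvec {x : ℝ} (hz : cycleOp a b c z = ρ • z) (hx : CharEq p m n a b c ρ x) :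
    ∑ j, normSq (eigenvec p m a b c z x j) =
      normSq z * ((x - p) * (x - m) - normSq a) * (((x - m) * (x - n) - normSq c) +
        ((x - p) * (x - n) - normSq b) + ((x - p) * (x - m) - normSq a)) := by
  rw [Fin.sum_univ_three, normSq_eigenvec_zero hz hx, normSq_eigenvec_one hz hx,
    normSq_eigenvec_two]
  ring

theorem hasEigenbasis_herm_of_injective (hz0 : z ≠ 0)
    (hz : cycleOp a b c z = (r + 2 * re (b * (a * c))) • z) {e : Fin 3 → ℝ}
    (he : Function.Injective e) (hfam : IsFamily (herm p m n a b c) r e)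
    (hq : ∀ i, (e i - p) * (e i - m) - normSq a ≠ 0) : HasEigenbasis (herm p m n a b c) r := by
  have hx := charEq_of_isFamily hfam
  have hν : normSq z ≠ 0 := fun h => hz0 (normSq_eq_zero.1 h)
  have hN : ∀ i, ∑ j, normSq (eigenvec p m a b c z (e i) j) =
      normSq z * ((e i - p) * (e i - m) - normSq a) * derivAt e i := fun i => by
    rw [sum_normSq_eigenvec hz (hx i), hfam.derivAt_eq]
  -- Positivity is automatic: this nonzero number is a sum of squared norms.
  have hpos : ∀ i, 0 < normSq z * ((e i - p) * (e i - m) - normSq a) * derivAt e i := fun i =>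
    lt_of_le_of_ne (hN i ▸ Finset.sum_nonneg fun j _ => normSq_nonneg _)
      (mul_ne_zero (mul_ne_zero hν (hq i)) (derivAt_ne_zero he i)).symm
  set s : Fin 3 → ℝ := fun i =>
    (Real.sqrt (normSq z * ((e i - p) * (e i - m) - normSq a) * derivAt e i))⁻¹ with hs
  have hs2 : ∀ i, s i ^ 2 = (normSq z * ((e i - p) * (e i - m) - normSq a) * derivAt e i)⁻¹ :=
    fun i => by rw [hs]; simp only; rw [inv_pow, Real.sq_sqrt (hpos i).le]
  refine hasEigenbasis_of_adjugate (C := adjConst p m n a b c z) he hfam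
    (v := fun i => s i • eigenvec p m a b c z (e i)) (fun i => ?_) (fun i => ?_) (fun i => ?_)
  · rw [Matrix.mulVec_smul, herm_mulVec_eigenvec hz (hx i), smul_comm]
  · simp only [Pi.smul_apply, normSq_smul]
    rw [← Finset.mul_sum, hN, hs2, inv_mul_cancel₀ (hpos i).ne']
  · have h1 : star (s i • eigenvec p m a b c z (e i)) = s i • star (eigenvec p m a b c z (e i)) :=
      funext fun j => by simp
    rw [h1, Matrix.smul_vecMulVec, Matrix.vecMulVec_smul, vecMulVec_eigenvec hz0 hz (hx i),
      smul_smul, smul_smul, adj, hfam.sum_eq]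
    congr 1
    have h2 := hq i
    have h3 := derivAt_ne_zero he i
    rw [← sq, hs2]
    field_simp

end

/-! ### Real distinct roots by interlacing. -/

section

theorem exists_gt_cubic_pos (α β γ M : ℝ) : ∃ x, M < x ∧ 0 < x ^ 3 + α * x ^ 2 + β * x + γ := by
  refine ⟨1 + |α| + |β| + |γ| + |M|, ?_, ?_⟩
  · linarith [le_abs_self M, abs_nonneg α, abs_nonneg β, abs_nonneg γ]
  · set x := 1 + |α| + |β| + |γ| + |M| with hx
    have hα := abs_nonneg α
    have hβ := abs_nonneg β
    have hγ := abs_nonneg γ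
    have hM := abs_nonneg M
    have h1 : 1 ≤ x := by linarith
    have h2 : 0 ≤ x ^ 2 - x := by nlinarith
    have h3 : 0 ≤ (x ^ 2 - x) * |β| := mul_nonneg h2 hβ
    have h4 : 0 ≤ (x ^ 2 - 1) * |γ| := mul_nonneg (by linarith) hγ
    have h5 : 0 ≤ x ^ 2 * |M| := by positivity
    have h6 : 0 ≤ (α + |α|) * x ^ 2 := mul_nonneg (by linarith [neg_abs_le α]) (by positivity)
    have h7 : 0 ≤ (β + |β|) * x := mul_nonneg (by linarith [neg_abs_le β]) (by linarith)
    have h8 : 0 ≤ γ + |γ| := by linarith [neg_abs_le γ]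
    have h9 : 0 < x ^ 2 := by positivity
    have h10 : x ^ 3 = x ^ 2 + x ^ 2 * |α| + x ^ 2 * |β| + x ^ 2 * |γ| + x ^ 2 * |M| := by
      rw [pow_succ]; nth_rw 2 [hx]; ring
    linarith

theorem cubic_eq_prod_of_roots {α β γ : ℝ} {e : Fin 3 → ℝ} (he : Function.Injective e)
    (h : ∀ i, e i ^ 3 + α * e i ^ 2 + β * e i + γ = 0) (x : ℝ) :
    x ^ 3 + α * x ^ 2 + β * x + γ = ∏ i, (x - e i) := by
  have h01 : e 0 - e 1 ≠ 0 := sub_ne_zero.2 (he.ne (by decide))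
  have h02 : e 0 - e 2 ≠ 0 := sub_ne_zero.2 (he.ne (by decide))
  have h12 : e 1 - e 2 ≠ 0 := sub_ne_zero.2 (he.ne (by decide))
  have h0 := h 0
  have k1 : e 0 ^ 2 + e 0 * e 1 + e 1 ^ 2 + α * (e 0 + e 1) + β = 0 :=
    mul_left_cancel₀ h01 (by linear_combination h 0 - h 1)
  have k2 : e 0 ^ 2 + e 0 * e 2 + e 2 ^ 2 + α * (e 0 + e 2) + β = 0 :=
    mul_left_cancel₀ h02 (by linear_combination h 0 - h 2)
  have k3 : e 0 + e 1 + e 2 + α = 0 :=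
    mul_left_cancel₀ h12 (by linear_combination k1 - k2)
  rw [Fin.prod_univ_three]
  linear_combination h0 + (x - e 0) * k1 + (x - e 0) * (x - e 1) * k3

variable {p m n ρ r : ℝ} {a b c z : Octonion}

/-- Times `|z|²`, the quadratic is `|ā (b̄ z) + t (c z)|²`. -/
theorem interlacing_quadratic_nonneg (hz0 : z ≠ 0) (hz : cycleOp a b c z = ρ • z) (t : ℝ) :
    0 ≤ normSq c * t ^ 2 + ρ * t + normSq a * normSq b := by
  have hν : 0 < normSq z :=
    lt_of_le_of_ne (normSq_nonneg z) fun h => hz0 (normSq_eq_zero.1 h.symm)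
  have h := two_mul_inner_of_cycleOp hz
  rw [inner_mul_left, inner_comm] at h
  have h1 := normSq_nonneg (star a * (star b * z) + t • (c * z))
  simp only [normSq_add, inner_smul_right, normSq_smul, normSq_mul, normSq_star] at h1
  refine le_of_mul_le_mul_left ?_ hν
  linear_combination h1 + t * h

/-- The minor `(x - p)(x - m) - |a|²` vanishes at `x = p + t` for two values of `t` of opposite
sign. There `t` times the cubic is minus the nonnegative quadratic, strictly negative by `hF`, so
the cubic is positive at the lower point and negative at the upper one. -/
theorem exists_isFamily_of_interlacing (ha : a ≠ 0) (hz0 : z ≠ 0)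
    (hz : cycleOp a b c z = (r + 2 * re (b * (a * c))) • z)
    (hF : ∀ t : ℝ, t ^ 2 + (p - m) * t = normSq a →
      normSq c * t ^ 2 + (r + 2 * re (b * (a * c))) * t + normSq a * normSq b ≠ 0) :
    ∃ e : Fin 3 → ℝ, Function.Injective e ∧ IsFamily (herm p m n a b c) r e ∧
      ∀ i, (e i - p) * (e i - m) - normSq a ≠ 0 := by
  have ha0 : 0 < normSq a :=
    lt_of_le_of_ne (normSq_nonneg a) fun h => ha (normSq_eq_zero.1 h.symm)
  obtain ⟨S, hS0, hS⟩ : ∃ S : ℝ, 0 < S ∧ S ^ 2 = (p - m) ^ 2 + 4 * normSq a :=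
    ⟨√((p - m) ^ 2 + 4 * normSq a), Real.sqrt_pos.2 (by positivity), Real.sq_sqrt (by positivity)⟩
  obtain ⟨hlt, hlt'⟩ := abs_lt.1 <| abs_lt_of_sq_lt_sq (show (p - m) ^ 2 < S ^ 2 by linarith) hS0.le
  set ρ := r + 2 * re (b * (a * c)) with hρ
  set f : ℝ → ℝ := fun x => x ^ 3 + (-(p + m + n)) * x ^ 2 +
    (p * m + p * n + m * n - normSq a - normSq b - normSq c) * x +
    (n * normSq a + m * normSq b + p * normSq c - p * m * n - ρ) with hf
  have hcont : Continuous f := by fun_prop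
  have key : ∀ t, t ^ 2 + (p - m) * t = normSq a → t * f (p + t) < 0 := by
    intro t ht
    have h1 := lt_of_le_of_ne (interlacing_quadratic_nonneg hz0 hz t) (hF t ht).symm
    have h2 : t * f (p + t) = -(normSq c * t ^ 2 + ρ * t + normSq a * normSq b) := by
      simp only [hf]
      linear_combination ((p + t - n) * t - normSq b) * ht
    linarith
  have hlo : 0 < f (p + (m - p - S) / 2) := by
    have h1 := key ((m - p - S) / 2) (by linear_combination hS / 4)
    have h2 : (m - p - S) / 2 < 0 := by linarith
    exact pos_of_mul_neg_right h1 h2.le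
  have hhi : f (p + (m - p + S) / 2) < 0 := by
    have h1 := key ((m - p + S) / 2) (by linear_combination hS / 4)
    have h2 : 0 < (m - p + S) / 2 := by linarith
    exact neg_of_mul_neg_right h1 h2.le
  obtain ⟨X, hX, hfX⟩ := exists_gt_cubic_pos (-(p + m + n))
    (p * m + p * n + m * n - normSq a - normSq b - normSq c)
    (n * normSq a + m * normSq b + p * normSq c - p * m * n - ρ) (p + (m - p + S) / 2)
  -- The cubic `-f (-x)`, to make `f` negative far to the left.
  obtain ⟨Y, hY, hfY⟩ := exists_gt_cubic_pos (p + m + n)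
    (p * m + p * n + m * n - normSq a - normSq b - normSq c)
    (-(n * normSq a + m * normSq b + p * normSq c - p * m * n - ρ)) (-(p + (m - p - S) / 2))
  have hfY' : f (-Y) < 0 := by simp only [hf]; linarith
  obtain ⟨x₀, hx₀, h₀⟩ := intermediate_value_Ioo (show -Y ≤ p + (m - p - S) / 2 by linarith)
    hcont.continuousOn ⟨hfY', hlo⟩
  obtain ⟨x₁, hx₁, h₁⟩ := intermediate_value_Ioo'
    (show p + (m - p - S) / 2 ≤ p + (m - p + S) / 2 by linarith) hcont.continuousOn ⟨hhi, hlo⟩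
  obtain ⟨x₂, hx₂, h₂⟩ := intermediate_value_Ioo (show p + (m - p + S) / 2 ≤ X by linarith)
    hcont.continuousOn ⟨hhi, hfX⟩
  have hinj : Function.Injective ![x₀, x₁, x₂] := by
    have h01 : x₀ < x₁ := hx₀.2.trans hx₁.1
    have h12 : x₁ < x₂ := hx₁.2.trans hx₂.1
    refine StrictMono.injective (Fin.strictMono_iff_lt_succ.2 fun i => ?_)
    fin_cases i
    · exact h01
    · exact h12
  have hroot : ∀ i, f (![x₀, x₁, x₂] i) = 0 := by
    intro i
    fin_cases i
    exacts [h₀, h₁, h₂]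
  refine ⟨![x₀, x₁, x₂], hinj, fun x => ?_, fun i => ?_⟩
  · rw [← cubic_eq_prod_of_roots hinj hroot, det_smul_one_sub_herm, hρ]; ring
  · have hfac : ∀ x, (x - p) * (x - m) - normSq a =
        (x - (p + (m - p - S) / 2)) * (x - (p + (m - p + S) / 2)) := fun x => by
      linear_combination hS / 4
    rw [hfac]
    fin_cases i
    · exact mul_ne_zero (sub_ne_zero.2 hx₀.2.ne)
        (sub_ne_zero.2 (hx₀.2.trans (hx₁.1.trans hx₁.2)).ne)
    · exact mul_ne_zero (sub_ne_zero.2 hx₁.1.ne') (sub_ne_zero.2 hx₁.2.ne)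
    · exact mul_ne_zero (sub_ne_zero.2 ((hx₁.1.trans hx₁.2).trans hx₂.1).ne')
        (sub_ne_zero.2 hx₂.1.ne')

end

/-! ### Topology of the octonions, closedness and degenerate cases. -/

section

instance : TopologicalSpace Octonion := .induced equivProd inferInstance

/-- `equivProd` as a homeomorphism. -/
def homeoProd : Octonion ≃ₜ ℍ[ℝ] × ℍ[ℝ] := equivProd.toEquiv.toHomeomorphOfIsInducing ⟨rfl⟩

instance : T2Space Octonion := homeoProd.symm.t2Space

@[fun_prop]
theorem continuous_fst : Continuous fst := _root_.continuous_fst.comp homeoProd.continuous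

@[fun_prop]
theorem continuous_snd : Continuous snd := _root_.continuous_snd.comp homeoProd.continuous

theorem continuous_of_components {X : Type*} [TopologicalSpace X] {f : X → Octonion}
    (h1 : Continuous fun x => (f x).fst) (h2 : Continuous fun x => (f x).snd) : Continuous f :=
  homeoProd.symm.continuous.comp (h1.prodMk h2)

instance : ContinuousAdd Octonion := ⟨continuous_of_components
  (by simp only [add_fst]; fun_prop) (by simp only [add_snd]; fun_prop)⟩

instance : ContinuousMul Octonion := ⟨continuous_of_components
  (by simp only [mul_fst]; fun_prop) (by simp only [mul_snd]; fun_prop)⟩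

instance : ContinuousStar Octonion := ⟨continuous_of_components
  (by simp only [star_fst]; fun_prop) (by simp only [star_snd]; fun_prop)⟩

instance : ContinuousSMul ℝ Octonion := ⟨continuous_of_components
  (by simp only [smul_fst]; fun_prop) (by simp only [smul_snd]; fun_prop)⟩

instance : ContinuousNeg Octonion := ⟨continuous_of_components
  (by simp only [neg_fst]; fun_prop) (by simp only [neg_snd]; fun_prop)⟩

instance : IsTopologicalAddGroup Octonion where

@[fun_prop]
theorem continuous_re : Continuous re := Quaternion.continuous_re.comp continuous_fst

theorem continuous_normSq : Continuous normSq := by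
  unfold normSq; fun_prop

theorem continuous_det : Continuous det := by
  unfold det
  have := continuous_normSq
  fun_prop

theorem isCompact_normSq_le_one : IsCompact {x : Octonion | normSq x ≤ 1} := by
  have h : IsCompact (homeoProd ⁻¹' Metric.closedBall (0 : ℍ[ℝ] × ℍ[ℝ]) 1) :=
    homeoProd.isCompact_preimage.2 (isCompact_closedBall _ _)
  refine h.of_isClosed_subset (isClosed_le continuous_normSq continuous_const) fun x hx => ?_
  rw [Set.mem_ofPred_eq, normSq_eq] at hx
  rw [Set.mem_preimage, mem_closedBall_zero_iff, Prod.norm_def, max_le_iff]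
  exact ⟨(pow_le_one_iff_of_nonneg (norm_nonneg _) two_ne_zero).1
      ((le_add_of_nonneg_right (sq_nonneg ‖x.snd‖)).trans hx),
    (pow_le_one_iff_of_nonneg (norm_nonneg _) two_ne_zero).1
      ((le_add_of_nonneg_left (sq_nonneg ‖x.fst‖)).trans hx)⟩

/-- Triples of unit vectors of `𝕆³`. -/
def unitTriples : Set (Fin 3 → Fin 3 → Octonion) := {v | ∀ m, star (v m) ⬝ᵥ v m = 1}

theorem isCompact_unitTriples : IsCompact unitTriples := by
  refine (isCompact_univ_pi fun _ : Fin 3 => isCompact_univ_pi fun _ : Fin 3 =>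
    isCompact_normSq_le_one).of_isClosed_subset ?_ fun v hv i _ j _ => ?_
  · simp only [unitTriples, Set.ofPred_forall, dotProduct]
    exact isClosed_iInter fun m => isClosed_eq
      (by simp only [Pi.star_apply]; fun_prop) continuous_const
  · have h := hv i
    rw [star_dotProduct_self, ← one_smul ℝ (1 : Octonion), smul_smul, mul_one] at h
    rw [Set.mem_ofPred_eq, ← smul_one_injective h]
    exact Finset.single_le_sum (fun j _ => normSq_nonneg (v i j)) (Finset.mem_univ j)

theorem eigenvalue_eq_re {A : Matrix (Fin 3) (Fin 3) Octonion} {v : Fin 3 → Octonion} {t : ℝ}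
    (hv : A *ᵥ v = t • v) (h1 : star v ⬝ᵥ v = 1) : t = re (star v ⬝ᵥ (A *ᵥ v)) := by
  rw [hv, dotProduct_smul, h1, re_smul, re_one, mul_one]

/-- All conditions are closed in `(t, v)` with `v` in a compact set, and projection along a compact
factor is a closed map. The eigenvalues need no separate bound, since `v` determines them as `Re (v†
A v)`. -/
theorem isClosed_hasEigenbasis {A : ℝ → Matrix (Fin 3) (Fin 3) Octonion} (hA : Continuous A)
    (r : ℝ) : IsClosed {t | HasEigenbasis (A t) r} := by
  let ev : ℝ × unitTriples → Fin 3 → ℝ := fun y m =>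
    re (star (y.2.1 m) ⬝ᵥ (A y.1 *ᵥ y.2.1 m))
  have hv : Continuous fun y : ℝ × unitTriples => y.2.1 := by fun_prop
  have hvm : ∀ m, Continuous fun y : ℝ × unitTriples => y.2.1 m := fun m =>
    (continuous_apply m).comp hv
  have hAy : Continuous fun y : ℝ × unitTriples => A y.1 := by fun_prop
  have hev : ∀ m, Continuous fun y => ev y m := fun m =>
    continuous_re.comp ((hvm m).star.dotProduct (hAy.matrix_mulVec (hvm m)))
  have hvec : ∀ m, Continuous fun y : ℝ × unitTriples =>
      Matrix.vecMulVec (y.2.1 m) (star (y.2.1 m)) := fun m =>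
    (hvm m).matrix_vecMulVec (hvm m).star
  have : CompactSpace unitTriples := isCompact_iff_compactSpace.1 isCompact_unitTriples
  let R : Set (ℝ × unitTriples) := {y | IsFamily (A y.1) r (ev y)} ∩
    {y | ∀ m, A y.1 *ᵥ y.2.1 m = ev y m • y.2.1 m} ∩
    {y | ∀ m k, m ≠ k → Matrix.vecMulVec (y.2.1 m) (star (y.2.1 m)) *ᵥ y.2.1 k = 0} ∩
    {y | ∑ m, Matrix.vecMulVec (y.2.1 m) (star (y.2.1 m)) = 1} ∩
    {y | A y.1 = ∑ m, ev y m • Matrix.vecMulVec (y.2.1 m) (star (y.2.1 m))}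
  have hR : IsClosed R := by
    refine ((((IsClosed.inter ?_ ?_).inter ?_).inter ?_).inter ?_)
    · simp only [IsFamily, Set.ofPred_forall]
      exact isClosed_iInter fun x => isClosed_eq
        ((continuous_det.comp (continuous_const.sub hAy)).sub continuous_const)
        (continuous_finsetProd _ fun m _ => continuous_const.sub (hev m))
    · simp only [Set.ofPred_forall]
      exact isClosed_iInter fun m => isClosed_eq (hAy.matrix_mulVec (hvm m))
        ((hev m).smul (hvm m))
    · simp only [Set.ofPred_forall]
      exact isClosed_iInter fun m => isClosed_iInter fun k => isClosed_iInter fun _ =>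
        isClosed_eq ((hvec m).matrix_mulVec (hvm k)) continuous_const
    · exact isClosed_eq (continuous_finsetSum _ fun m _ => hvec m) continuous_const
    · exact isClosed_eq hAy (continuous_finsetSum _ fun m _ => (hev m).smul (hvec m))
  have himage : {t | HasEigenbasis (A t) r} = Prod.fst '' R := by
    ext t
    constructor
    · rintro ⟨e, v, h1, h2, h3, h4⟩
      have he : e = fun m => re (star (v m) ⬝ᵥ (A t *ᵥ v m)) :=
        funext fun m => eigenvalue_eq_re (h2 m) (h3.unit m)
      subst he
      exact ⟨(t, ⟨v, h3.unit⟩), ⟨⟨⟨⟨h1, h2⟩, h3.orthogonal⟩, h3.complete⟩, h4⟩, rfl⟩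
    · rintro ⟨⟨t, v⟩, ⟨⟨⟨⟨h1, h2⟩, h3⟩, h4⟩, h5⟩, rfl⟩
      exact ⟨ev (t, v), v.1, h1, h2, ⟨v.2, h3, h4⟩, h5⟩
  rw [himage]
  exact isClosedMap_fst_of_compactSpace _ hR

theorem continuous_herm {p m n : ℝ → ℝ} {a b c : ℝ → Octonion} (hp : Continuous p)
    (hm : Continuous m) (hn : Continuous n) (ha : Continuous a) (hb : Continuous b)
    (hc : Continuous c) :
    Continuous fun t => herm (p t) (m t) (n t) (a t) (b t) (c t) := by
  refine continuous_matrix fun i j => ?_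
  fin_cases i <;> fin_cases j
  exacts [hp.smul continuous_const, ha, hb.star, ha.star, hm.smul continuous_const, hc, hb,
    hc.star, hn.smul continuous_const]

variable {p m n r : ℝ} {a b c z : Octonion}

/-- Shifting `p` leaves `z` and `r` untouched, and interlacing fails to be strict for at most one
shift. -/
theorem hasEigenbasis_herm_of_ne_zero (ha : a ≠ 0) (hc : c ≠ 0) (hz0 : z ≠ 0)
    (hz : cycleOp a b c z = (r + 2 * re (b * (a * c))) • z) :
    HasEigenbasis (herm p m n a b c) r := by
  set ρ := r + 2 * re (b * (a * c)) with hρ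
  have hc0 : 0 < normSq c :=
    lt_of_le_of_ne (normSq_nonneg c) fun h => hc (normSq_eq_zero.1 h.symm)
  have ha0 : 0 < normSq a :=
    lt_of_le_of_ne (normSq_nonneg a) fun h => ha (normSq_eq_zero.1 h.symm)
  let bad : Set ℝ := {t | ∃ s : ℝ, s ^ 2 + (p + t - m) * s = normSq a ∧
    normSq c * s ^ 2 + ρ * s + normSq a * normSq b = 0}
  have hbad : bad.Subsingleton := by
    rintro t ⟨s, hs, hs'⟩ t' ⟨s', ht, ht'⟩
    -- At the midpoint of two zeros the quadratic equals `-|c|² (s - s')² / 4`, so nonnegativity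
    -- forces a single zero `s`, which in turn determines the shift.
    have hmid := interlacing_quadratic_nonneg hz0 hz ((s + s') / 2)
    have hss : s = s' := by
      have h1 : normSq c * (s - s') ^ 2 ≤ 0 := by linarith
      have h2 : (s - s') ^ 2 = 0 :=
        le_antisymm (nonpos_of_mul_nonpos_right h1 hc0) (sq_nonneg _)
      exact sub_eq_zero.1 (pow_eq_zero_iff two_ne_zero |>.1 h2)
    subst hss
    have hs0 : s ≠ 0 := by
      rintro rfl
      simp at hs
      exact ha0.ne hs
    apply mul_right_cancel₀ hs0
    linarith
  have hdense : Dense badᶜ := hbad.countable.dense_compl ℝ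
  have hcl : IsClosed {t | HasEigenbasis (herm (p + t) m n a b c) r} :=
    isClosed_hasEigenbasis (continuous_herm (by fun_prop) continuous_const continuous_const
      continuous_const continuous_const continuous_const) r
  have hsub : badᶜ ⊆ {t | HasEigenbasis (herm (p + t) m n a b c) r} := fun t ht => by
    obtain ⟨e, he, hfam, hq⟩ := exists_isFamily_of_interlacing (p := p + t) (m := m) (n := n) ha
      hz0 hz fun s hs hs' => ht ⟨s, hs, hs'⟩
    exact hasEigenbasis_herm_of_injective hz0 hz he hfam hq
  have h0 : (0 : ℝ) ∈ {t | HasEigenbasis (herm (p + t) m n a b c) r} :=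
    hcl.closure_subset_iff.2 hsub (hdense 0)
  simpa using h0

/-- `x` if it is nonzero, and `t` otherwise. -/
def perturb (x : Octonion) (t : ℝ) : Octonion :=
  open Classical in if x = 0 then t • 1 else x

theorem perturb_ne_zero (x : Octonion) {t : ℝ} (ht : t ≠ 0) : perturb x t ≠ 0 := by
  unfold perturb
  split_ifs with h
  · intro h1
    apply ht
    rw [← zero_smul ℝ (1 : Octonion)] at h1
    exact smul_one_injective h1
  · exact h

theorem perturb_zero (x : Octonion) : perturb x 0 = x := by
  unfold perturb
  split_ifs with h
  · rw [h, zero_smul]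
  · rfl

theorem continuous_perturb (x : Octonion) : Continuous (perturb x) := by
  unfold perturb
  split_ifs <;> fun_prop

/-- Zero entries among `a`, `c` are replaced by a real `t`. The associator still vanishes, so `z =
1` works with `r = 0` for every `t ≠ 0`. -/
theorem hasEigenbasis_herm_zero_left_or_right (h : a = 0 ∨ c = 0) :
    HasEigenbasis (herm p m n a b c) 0 := by
  have hcl : IsClosed {t | HasEigenbasis (herm p m n (perturb a t) b (perturb c t)) 0} :=
    isClosed_hasEigenbasis (continuous_herm continuous_const continuous_const continuous_const
      (continuous_perturb a) continuous_const (continuous_perturb c)) 0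
  have hsub : {0}ᶜ ⊆ {t : ℝ | HasEigenbasis (herm p m n (perturb a t) b (perturb c t)) 0} := by
    intro t ht
    refine hasEigenbasis_herm_of_ne_zero (z := 1) (perturb_ne_zero a ht) (perturb_ne_zero c ht)
      (fun h => ?_) ?_
    · simpa [h, re_zero] using re_one
    · rw [cycleOp_one, zero_add]
      have : assoc (perturb a t) b (perturb c t) = 0 := by
        have h0 : perturb 0 t = t • 1 := if_pos rfl
        rcases h with rfl | rfl <;>
          simp only [h0, assoc, smul_mul_assoc, mul_smul_comm, one_mul, mul_one, sub_self]
      rw [this, add_zero]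
  have h0 := hcl.closure_subset_iff.2 hsub ((Set.countable_singleton 0).dense_compl ℝ 0)
  simpa [perturb_zero] using h0

theorem hasEigenbasis_herm
    (hr : r ^ 2 + 4 * Phi a b c * r - normSq (assoc a b c) = 0) :
    HasEigenbasis (herm p m n a b c) r := by
  by_cases h : a = 0 ∨ c = 0
  · have h1 : assoc a b c = 0 := by rcases h with rfl | rfl <;> simp [assoc]
    have h2 : Phi a b c = 0 := by rcases h with rfl | rfl <;> simp [Phi, re_zero]
    have h3 : r = 0 := by simpa [h1, h2, normSq_eq_zero.2 rfl] using hr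
    rw [h3]
    exact hasEigenbasis_herm_zero_left_or_right h
  · rw [not_or] at h
    obtain ⟨z, hz0, hz⟩ := exists_cycleOp_eq_smul hr
    exact hasEigenbasis_herm_of_ne_zero h.1 h.2 hz0 hz

theorem exists_isFamilyLabel (A : Matrix (Fin 3) (Fin 3) Octonion) : ∃ r, IsFamilyLabel A r := by
  set φ := Phi (A 0 1) (A 2 0) (A 1 2) with hφ
  set N := normSq (assoc (A 0 1) (A 2 0) (A 1 2)) with hN
  have h : 0 ≤ 4 * φ ^ 2 + N := by
    have := normSq_nonneg (assoc (A 0 1) (A 2 0) (A 1 2))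
    positivity
  refine ⟨-2 * φ + √(4 * φ ^ 2 + N), ?_⟩
  rw [IsFamilyLabel, ← hφ, ← hN]
  linear_combination Real.sq_sqrt h

end

end

end Octonion

theorem theorem3 (A : Matrix (Fin 3) (Fin 3) Octonion) (hA : A.IsHermitian) :
    (∃ r : ℝ, Octonion.IsFamilyLabel A r) ∧
    ∀ r : ℝ, Octonion.IsFamilyLabel A r →
      ∃ (ev : Fin 3 → ℝ) (v : Fin 3 → Fin 3 → Octonion),
        Octonion.IsFamily A r ev ∧
        (∀ m, A *ᵥ v m = ev m • v m) ∧
        Octonion.IsOrthonormalBasis v ∧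
        A = ∑ m, ev m • Matrix.vecMulVec (v m) (star (v m)) := by
  refine ⟨Octonion.exists_isFamilyLabel A, fun r hr => ?_⟩
  have h := Octonion.hasEigenbasis_herm (p := Octonion.re (A 0 0)) (m := Octonion.re (A 1 1))
    (n := Octonion.re (A 2 2)) hr
  rwa [← Octonion.eq_herm hA] at h
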